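/- **Setting.** Let $m>1$, $n\ge 0$. Let $M$ and $F$ be smooth manifolds with $\dim M=m$ and $\dim F=m+n$, let $\kappa\colon F\to M$ be a fibred manifold (a smooth surjective submersion, for example a fibre bundle), $\eta$ a volume form on $M$, and $\Omega$ a closed $(m+1)$-form on $F$. Write $\mathrm V_y(\kappa)=\ker \mathrm T_y\kappa$ for the vertical subspace at $y\in F$ and assume that $\Omega$ vanishes whenever three of its arguments are vertical. Let $\nabla$ be an Ehresmann connection in $\kappa$, that is, a smooth family of linear maps $\nabla(y)\colon \mathrm T_{\kappa(y)}M\to \mathrm T_yF$ with $\mathrm T_y\kappa\circ\nabla(y)=\mathrm{Id}$; put $\mathrm H_y(\nabla)=\operatorname{Im}\nabla(y)$, so that $\mathrm T_yF=\mathrm H_y(\nabla)\oplus\mathrm V_y(\kappa)$, and let $(\mathrm T_y\kappa_{\mathrm H(\nabla)})^{-1}\colon \mathrm T_{\kappa(y)}M\to\mathrm H_y(\nabla)$ be the horizontal lift, the inverse of $\mathrm T_y\kappa|_{\mathrm H_y(\nabla)}$. Let $\mathcal Y^\nabla_\eta(y)\in\Lambda^m\mathrm T_yF$ be the image under $\Lambda^m\nabla(y)$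 of the unique $\mathcal Z\in\Lambda^m\mathrm T_{\kappa(y)}M$ with $\eta(\mathcal Z)=1$, and let $\gamma^\nabla_\eta(y)=i(\mathcal Y^\nabla_\eta(y))\Omega(y)\in \mathrm T_y^*F$, where $i(w_1\wedge\dots\wedge w_m)\Omega=\Omega(w_1,\dots,w_m,\cdot)$. Let $C\hookrightarrow F$ be a submanifold and $y\in C$. For a linear map $\mathbf h_y\colon \mathrm T_{\kappa(y)}M\to \mathrm T_yC\subseteq\mathrm T_yF$ let $(\mathbf h_y)^H_\nabla$ and $(\mathbf h_y)^V_\nabla$ be its horizontal and vertical parts, and $\widetilde{(\mathbf h_y)^V_\nabla}=(\mathbf h_y)^V_\nabla\circ \mathrm T_y\kappa$. For an endomorphism $A$ of $\mathrm T_yF$ put $i(A^t)(w_1\wedge\dots\wedge w_m)=\sum_\alpha w_1\wedge\dots\wedge A w_\alpha\wedge\dots\wedge w_m$, extended linearly. Define the linear map $$\flat^\nabla_\Omega(y)(\mathbf h_y)=\Big((\mathbf h_y)^H_\nabla,\ \big[i\big(i([\widetilde{(\mathbf h_y)^V_\nabla}]^t)\mathcal Y^\nabla_\eta(y)\big)\Omega(y)\big]\big|_{\mathrm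 V_y(\kappa)}\Big)\in (\mathrm T^*_{\kappa(y)}M\otimes \mathrm H_y(\nabla))\times \mathrm V_y^*(\kappa).$$ Let $\mathrm V_y(\kappa)^0\subseteq \mathrm T_y^*F$ be the annihilator of $\mathrm V_y(\kappa)$, and pair $\mathrm T_{\kappa(y)}M\otimes\mathrm V_y(\kappa)^0$ with $\mathrm T^*_{\kappa(y)}M\otimes\mathrm H_y(\nabla)\cong \mathrm{Lin}(\mathrm T_{\kappa(y)}M,\mathrm H_y(\nabla))$ by $(e\otimes\beta)(g)=\beta(g(e))$. Let $(\mathrm T_y^\perp C)^\nabla_\Omega=(\operatorname{Im}\flat^\nabla_\Omega(y))^0$, the subspace of all $(\mathbf h_y^*,Z_y)\in(\mathrm T_{\kappa(y)}M\otimes\mathrm V_y(\kappa)^0)\times\mathrm V_y(\kappa)$ with $\mathbf h^*_y(g)+\xi(Z_y)=0$ for every $(g,\xi)\in\operatorname{Im}\flat^\nabla_\Omega(y)$. **Theorem.** The following are equivalent. 1. There exists a linear map $\mathbf h_y\colon \mathrm T_{\kappa(y)}M\to\mathrm T_yC$ such that $$(\mathbf h_y)^H_\nabla=(\mathrm T_y\kappa_{\mathrm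 H(\nabla)})^{-1},\qquad \big[i\big(i([\widetilde{(\mathbf h_y)^V_\nabla}]^t)\mathcal Y^\nabla_\eta(y)\big)\Omega(y)\big]\big|_{\mathrm V_y(\kappa)}=-\gamma^\nabla_\eta(y)\big|_{\mathrm V_y(\kappa)}.$$ 2. There exists a linear map $\mathbf h_y\colon \mathrm T_{\kappa(y)}M\to\mathrm T_yC$ solving the field equations at $y$, that is, $\mathrm T_y\kappa\circ\mathbf h_y=\mathrm{Id}$ and $\Omega(y)(\mathbf h_y(X_1),\dots,\mathbf h_y(X_m),Y)=0$ for all $X_1,\dots,X_m\in\mathrm T_{\kappa(y)}M$ and $Y\in\mathrm T_yF$. 3. $\mathbf h_y^*\big((\mathrm T_y\kappa_{\mathrm H(\nabla)})^{-1}\big)-\gamma^\nabla_\eta(y)(Z_y)=0$ for every $(\mathbf h_y^*,Z_y)\in(\mathrm T_y^\perp C)^\nabla_\Omega$. -/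

import Mathlib

open Set Module
open scoped Manifold ContDiff TensorProduct

noncomputable section

/-! ## Linear algebra -/

namespace PreMultisymplectic

section MultiVectors

variable {W E : Type*} [AddCommGroup W] [Module ℝ W] [AddCommGroup E] [Module ℝ E] {m : ℕ}

/-- The value `η(Z)` of an alternating `m`-form on an `m`-vector. -/
def evalMV (η : E [⋀^Fin m]→ₗ[ℝ] ℝ) : ⋀[ℝ]^m E →ₗ[ℝ] ℝ :=
  exteriorPower.alternatingMapLinearEquiv η

/-- The interior product `i(Y)Ω` of an `(m+1)`-form with an `m`-vector, a linear form on `W`.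
On decomposable `m`-vectors it is `w ↦ Ω(w₁, …, wₘ, w)`, see `contract_ιMulti`. -/
def contract (Ω : W [⋀^Fin (m + 1)]→ₗ[ℝ] ℝ) : ⋀[ℝ]^m W →ₗ[ℝ] Dual ℝ W :=
  (-1 : ℝ) ^ m • ((exteriorPower.alternatingMapLinearEquiv (R := ℝ) (M := W) (n := m)
    (N := ℝ)).toLinearMap ∘ₗ Ω.curryLeft).flip

theorem contract_ιMulti (Ω : W [⋀^Fin (m + 1)]→ₗ[ℝ] ℝ) (v : Fin m → W) (w : W) :
    contract Ω (exteriorPower.ιMulti ℝ m v) w = Ω (Fin.snoc v w) := by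
  have h : (Fin.snoc v w : Fin (m + 1) → W) = Matrix.vecCons w v ∘ (finRotate (m + 1)) := by
    funext i
    refine Fin.lastCases ?_ (fun i => ?_) i
    · simp
    · simp [Matrix.vecCons]
  rw [h, AlternatingMap.map_perm, sign_finRotate]
  simp [contract, Units.smul_def]

/-- The alternating map `v ↦ ∑_α v₁ ∧ … ∧ A v_α ∧ … ∧ vₘ`. -/
def derivAlt (A : W →ₗ[ℝ] W) : W [⋀^Fin m]→ₗ[ℝ] ⋀[ℝ]^m W where
  toMultilinearMap := ∑ i : Fin m,
    (exteriorPower.ιMulti ℝ m (M := W)).toMultilinearMap.compLinearMap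
      (fun j => if j = i then A else LinearMap.id)
  map_eq_zero_of_eq' := by
    intro v a b hv hab
    have key : ∀ i : Fin m, (fun j => (if j = i then A else LinearMap.id : W →ₗ[ℝ] W) (v j))
        = Function.update v i (A (v i)) := by
      intro i; funext j
      by_cases h : j = i
      · subst h; simp
      · simp [h]
    simp only [MultilinearMap.toFun_eq_coe, sum_apply,
      MultilinearMap.compLinearMap_apply, AlternatingMap.coe_multilinearMap, key]
    rw [← Finset.sum_subset (Finset.subset_univ {a, b}), Finset.sum_pair hab]
    · have : Function.update v a (A (v a)) =
          Function.update v b (A (v b)) ∘ Equiv.swap a b := by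
        funext j
        by_cases hja : j = a
        · subst hja; simp [hv]
        · by_cases hjb : j = b
          · subst hjb; simp [hv, hab, Ne.symm hab]
          · simp [hja, hjb, Equiv.swap_apply_of_ne_of_ne]
      rw [this, AlternatingMap.map_swap _ _ hab, neg_add_cancel]
    · intro i _ hi
      simp only [Finset.mem_insert, Finset.mem_singleton, not_or] at hi
      refine AlternatingMap.map_eq_zero_of_eq _ _ ?_ hab
      rw [Function.update_of_ne (Ne.symm hi.1), Function.update_of_ne (Ne.symm hi.2), hv]

theorem derivAlt_apply (A : W →ₗ[ℝ] W) (v : Fin m → W) :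
    derivAlt A v = ∑ i, exteriorPower.ιMulti ℝ m (Function.update v i (A (v i))) := by
  have key : ∀ i : Fin m, (fun j => (if j = i then A else LinearMap.id : W →ₗ[ℝ] W) (v j))
      = Function.update v i (A (v i)) := by
    intro i; funext j
    by_cases h : j = i
    · subst h; simp
    · simp [h]
  change (∑ i : Fin m, (exteriorPower.ιMulti ℝ m (M := W)).toMultilinearMap.compLinearMap
      (fun j => if j = i then A else LinearMap.id)) v = _
  simp only [sum_apply,
      MultilinearMap.compLinearMap_apply, AlternatingMap.coe_multilinearMap, key]

/-- The interior product `A ↦ i(Aᵗ)Y` of endomorphisms `A` of `W` with `m`-vectors, namely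
the extension of `A` to `m`-vectors as a derivation:
`w₁ ∧ … ∧ wₘ ↦ ∑_α w₁ ∧ … ∧ A w_α ∧ … ∧ wₘ`, see `deriv_ιMulti`. -/
def deriv : (W →ₗ[ℝ] W) →ₗ[ℝ] ⋀[ℝ]^m W →ₗ[ℝ] ⋀[ℝ]^m W where
  toFun A := exteriorPower.alternatingMapLinearEquiv (derivAlt A)
  map_add' A B := by
    rw [← map_add]
    congr 1
    ext1 v
    simp only [AlternatingMap.add_apply, derivAlt_apply, LinearMap.add_apply,
      AlternatingMap.map_update_add, Finset.sum_add_distrib]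
  map_smul' c A := by
    rw [RingHom.id_apply, ← map_smul]
    congr 1
    ext1 v
    simp only [AlternatingMap.smul_apply, derivAlt_apply, LinearMap.smul_apply,
      AlternatingMap.map_update_smul, Finset.smul_sum]

theorem deriv_ιMulti (A : W →ₗ[ℝ] W) (v : Fin m → W) :
    deriv A (exteriorPower.ιMulti ℝ m v) =
      ∑ i, exteriorPower.ιMulti ℝ m (Function.update v i (A (v i))) := by
  simp [deriv, derivAlt_apply]

variable [FiniteDimensional ℝ E]

/-- The `m`-vector `Z` on an `m`-dimensional space with `η(Z) = 1`, where `η` is a volume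
element: see `evalMV_unitMV` and `unitMV_unique`. -/
def unitMV (hE : finrank ℝ E = m) (η : E [⋀^Fin m]→ₗ[ℝ] ℝ) : ⋀[ℝ]^m E :=
  (η (finBasisOfFinrankEq ℝ E hE))⁻¹ • exteriorPower.ιMulti ℝ m (finBasisOfFinrankEq ℝ E hE)

theorem evalMV_unitMV (hE : finrank ℝ E = m) {η : E [⋀^Fin m]→ₗ[ℝ] ℝ} (hη : η ≠ 0) :
    evalMV η (unitMV hE η) = 1 := by
  have h0 : η (finBasisOfFinrankEq ℝ E hE) ≠ 0 :=
    fun h => hη ((AlternatingMap.map_basis_eq_zero_iff _ η).1 h)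
  simp [evalMV, unitMV, h0]

theorem unitMV_unique (hE : finrank ℝ E = m) {η : E [⋀^Fin m]→ₗ[ℝ] ℝ} (hη : η ≠ 0)
    (Z : ⋀[ℝ]^m E) (hZ : evalMV η Z = 1) : Z = unitMV hE η := by
  have h1 : finrank ℝ (⋀[ℝ]^m E) = 1 := by rw [exteriorPower.finrank_eq, hE, Nat.choose_self]
  have hu := evalMV_unitMV hE hη
  have hne : unitMV hE η ≠ 0 := by
    intro h; rw [h, map_zero] at hu; exact zero_ne_one hu
  obtain ⟨c, rfl⟩ := (finrank_eq_one_iff_of_nonzero' _ hne).1 h1 Z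
  rw [map_smul, hu, smul_eq_mul, mul_one] at hZ
  rw [hZ, one_smul]

end MultiVectors

section Splitting

variable {W E C : Type*} [AddCommGroup W] [Module ℝ W] [AddCommGroup E] [Module ℝ E]
  [AddCommGroup C] [Module ℝ C]

/-- A section `s` of a surjective linear map `σ : W → E`, i.e. `σ ∘ s = id`. Its horizontal
subspace is `LinearMap.range s`; the vertical subspace is `LinearMap.ker σ`. -/
structure LinSection (σ : W →ₗ[ℝ] E) where
  lift : E →ₗ[ℝ] W
  comp_lift : ∀ e, σ (lift e) = e

variable {σ : W →ₗ[ℝ] E} (s : LinSection σ)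

namespace LinSection

/-- The horizontal subspace. -/
abbrev hor : Submodule ℝ W := LinearMap.range s.lift

/-- The projection of `W = H ⊕ V` onto the horizontal subspace. -/
def projH : W →ₗ[ℝ] s.hor := s.lift.rangeRestrict ∘ₗ σ

/-- The projection of `W = H ⊕ V` onto the vertical subspace. -/
def projV : W →ₗ[ℝ] LinearMap.ker σ :=
  LinearMap.codRestrict (LinearMap.ker σ) (LinearMap.id - s.lift ∘ₗ σ) (fun w => by
    simp [s.comp_lift])

theorem projH_add_projV (w : W) : (s.projH w : W) + (s.projV w : W) = w := by
  simp [projH, projV]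

/-- The restriction of `σ` to the horizontal subspace, an isomorphism onto `E`. -/
def horEquiv : s.hor ≃ₗ[ℝ] E where
  toLinearMap := σ ∘ₗ s.hor.subtype
  invFun := s.lift.rangeRestrict
  left_inv := by
    rintro ⟨_, e, rfl⟩
    ext
    simp [s.comp_lift]
  right_inv e := by simp [s.comp_lift]

/-- The horizontal lift `(σ|_H)⁻¹ : E → H`. -/
def horLift : E →ₗ[ℝ] s.hor := s.horEquiv.symm.toLinearMap

/-- The horizontal part `h^H : E → H` of `h : E → C`, where `ι : C → W` is the inclusion. -/
def partH (ι : C →ₗ[ℝ] W) : (E →ₗ[ℝ] C) →ₗ[ℝ] (E →ₗ[ℝ] s.hor) :=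
  LinearMap.compRight ℝ (s.projH ∘ₗ ι)

/-- The endomorphism `h^V ∘ σ` of `W`, where `h^V : E → V` is the vertical part of
`h : E → C` and `ι : C → W` is the inclusion. -/
def tildeV (ι : C →ₗ[ℝ] W) : (E →ₗ[ℝ] C) →ₗ[ℝ] (W →ₗ[ℝ] W) :=
  LinearMap.lcomp ℝ W σ ∘ₗ LinearMap.compRight ℝ ((LinearMap.ker σ).subtype ∘ₗ s.projV ∘ₗ ι)

theorem partH_apply (ι : C →ₗ[ℝ] W) (h : E →ₗ[ℝ] C) (e : E) :
    s.partH ι h e = s.projH (ι (h e)) := rfl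

theorem tildeV_apply (ι : C →ₗ[ℝ] W) (h : E →ₗ[ℝ] C) (w : W) :
    s.tildeV ι h w = (s.projV (ι (h (σ w))) : W) := rfl

/-- The natural pairing of `E ⊗ V⁰` with `E* ⊗ H = Lin(E, H)`, where `V⁰ ⊆ W*` is the
annihilator of the vertical subspace: `⟨e ⊗ β, g⟩ = β(g(e))`. -/
def pairH : E ⊗[ℝ] (LinearMap.ker σ).dualAnnihilator →ₗ[ℝ] Dual ℝ (E →ₗ[ℝ] s.hor) :=
  TensorProduct.lift (LinearMap.mk₂ ℝ
    (fun e β => (β : Dual ℝ W) ∘ₗ s.hor.subtype ∘ₗ LinearMap.applyₗ e)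
    (fun _ _ _ => by ext; simp) (fun _ _ _ => by ext; simp)
    (fun _ _ _ => by ext; simp) (fun _ _ _ => by ext; simp))

theorem pairH_tmul (e : E) (β : (LinearMap.ker σ).dualAnnihilator) (g : E →ₗ[ℝ] s.hor) :
    s.pairH (e ⊗ₜ β) g = (β : Dual ℝ W) (g e : W) := rfl

/-- The natural pairing of `(E ⊗ V⁰) × V` with `(E* ⊗ H) × V*`:
`⟨(h*, Z), (g, ξ)⟩ = ⟨h*, g⟩ + ξ(Z)`. -/
def pairing : (E ⊗[ℝ] (LinearMap.ker σ).dualAnnihilator) × LinearMap.ker σ →ₗ[ℝ]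
    Dual ℝ ((E →ₗ[ℝ] s.hor) × Dual ℝ (LinearMap.ker σ)) :=
  ((LinearMap.fst ℝ (E →ₗ[ℝ] s.hor) (Dual ℝ (LinearMap.ker σ))).dualMap ∘ₗ s.pairH).coprod
    ((LinearMap.snd ℝ (E →ₗ[ℝ] s.hor) (Dual ℝ (LinearMap.ker σ))).dualMap ∘ₗ
      Dual.eval ℝ (LinearMap.ker σ))

theorem pairing_apply (p : (E ⊗[ℝ] (LinearMap.ker σ).dualAnnihilator) × LinearMap.ker σ)
    (q : (E →ₗ[ℝ] s.hor) × Dual ℝ (LinearMap.ker σ)) :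
    s.pairing p q = s.pairH p.1 q.1 + q.2 p.2 := rfl

variable [FiniteDimensional ℝ E] {m : ℕ} (hE : finrank ℝ E = m) (η : E [⋀^Fin m]→ₗ[ℝ] ℝ)
  (Ω : W [⋀^Fin (m + 1)]→ₗ[ℝ] ℝ)

/-- The `m`-vector `Y` on `W` associated with the section and the volume element `η`. -/
def mVector : ⋀[ℝ]^m W := exteriorPower.map m s.lift (unitMV hE η)

/-- The linear form `γ = i(Y)Ω`. -/
def gamma : Dual ℝ W := contract Ω (s.mVector hE η)

/-- The map `♭ : E* ⊗ C → (E* ⊗ H) × V*`, `h ↦ (h^H, i(i((h^V ∘ σ)ᵗ)Y)Ω |_V)`, where tensor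
products `E* ⊗ _` are written as spaces of linear maps from `E`. -/
def flat (ι : C →ₗ[ℝ] W) :
    (E →ₗ[ℝ] C) →ₗ[ℝ] (E →ₗ[ℝ] s.hor) × Dual ℝ (LinearMap.ker σ) :=
  (s.partH ι).prod ((LinearMap.ker σ).subtype.dualMap ∘ₗ contract Ω ∘ₗ
    deriv.flip (s.mVector hE η) ∘ₗ s.tildeV ι)

/-- The orthogonal complement of `C` with respect to `Ω` and the section: the annihilator of
the image of `♭` in `(E ⊗ V⁰) × V`. -/
def orthogonal (ι : C →ₗ[ℝ] W) :
    Submodule ℝ ((E ⊗[ℝ] (LinearMap.ker σ).dualAnnihilator) × LinearMap.ker σ) :=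
  (LinearMap.range (s.flat hE η Ω ι)).dualAnnihilator.comap s.pairing

end LinSection

end Splitting

/-! ## Geometry -/

section Geometry

/-- A differential `k`-form (not necessarily smooth) on a manifold modelled on `ℝ^d`. -/
abbrev Form (d k : ℕ) (N : Type*) [TopologicalSpace N]
    [ChartedSpace (EuclideanSpace ℝ (Fin d)) N] :=
  (x : N) → TangentSpace (𝓡 d) x [⋀^Fin k]→L[ℝ] ℝ

section Forms

variable {d k : ℕ} {N : Type*} [TopologicalSpace N] [ChartedSpace (EuclideanSpace ℝ (Fin d)) N]

/-- The coordinate representation of a form in the chart at `p` : its pullback by the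
inverse of the chart, a form on (the image of the chart in) `ℝ^d`. -/
def Form.inChart (α : Form d k N) (p : N) (z : EuclideanSpace ℝ (Fin d)) :
    EuclideanSpace ℝ (Fin d) [⋀^Fin k]→L[ℝ] ℝ :=
  (α ((extChartAt (𝓡 d) p).symm z)).compContinuousLinearMap
    (mfderiv 𝓘(ℝ, EuclideanSpace ℝ (Fin d)) (𝓡 d) (extChartAt (𝓡 d) p).symm z)

/-- The form is smooth: its coefficients in charts are smooth functions. -/
def Form.IsSmooth (α : Form d k N) : Prop :=
  ∀ p : N, ContDiffOn ℝ ∞ (α.inChart p) (extChartAt (𝓡 d) p).target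

/-- The form is closed: in charts its exterior derivative vanishes. -/
def Form.IsClosed (α : Form d k N) : Prop :=
  ∀ p : N, ∀ z ∈ (extChartAt (𝓡 d) p).target, extDeriv (α.inChart p) z = 0

end Forms

variable (m n : ℕ) (M F : Type*)
  [TopologicalSpace M] [ChartedSpace (EuclideanSpace ℝ (Fin m)) M]
  [TopologicalSpace F] [ChartedSpace (EuclideanSpace ℝ (Fin (m + n))) F]

/-- A fibred manifold `κ : F → M` (surjective submersion) over an `m`-dimensional manifold
with volume form `η`, and a closed `(m+1)`-form `Ω` on `F`. -/
structure System where
  κ : F → M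
  κ_smooth : ContMDiff (𝓡 (m + n)) (𝓡 m) ∞ κ
  κ_surjective : Function.Surjective κ
  κ_submersion : ∀ y, Function.Surjective (mfderiv (𝓡 (m + n)) (𝓡 m) κ y)
  η : Form m m M
  η_smooth : η.IsSmooth
  η_ne_zero : ∀ x, η x ≠ 0
  Ω : Form (m + n) (m + 1) F
  Ω_smooth : Ω.IsSmooth
  Ω_closed : Ω.IsClosed

variable {m n M F}

/-- An Ehresmann connection in `κ : F → M`: a smooth family of linear maps
`∇(y) : T_{κ(y)} M → T_y F` that are right inverse to `T_y κ`. The horizontal subspace at `y`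
is the image of `∇(y)`. -/
structure Connection [IsManifold (𝓡 m) ∞ M] [IsManifold (𝓡 (m + n)) ∞ F] (κ : F → M) where
  lift : (y : F) → TangentSpace (𝓡 m) (κ y) →L[ℝ] TangentSpace (𝓡 (m + n)) y
  comp_lift : ∀ y X, mfderiv (𝓡 (m + n)) (𝓡 m) κ y (lift y X) = X
  smooth : haveI : IsManifold (𝓡 m) 1 M := .of_le (n := ∞) (by norm_cast)
    haveI : IsManifold (𝓡 (m + n)) 1 F := .of_le (n := ∞) (by norm_cast)
    ∀ y₀ : F, ContMDiffAt (𝓡 (m + n))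
      𝓘(ℝ, EuclideanSpace ℝ (Fin m) →L[ℝ] EuclideanSpace ℝ (Fin (m + n))) ∞
      (inTangentCoordinates (𝓡 m) (𝓡 (m + n)) κ id lift y₀) y₀

instance finiteDimensional_tangentSpace (d : ℕ) (N : Type*) [TopologicalSpace N]
    [ChartedSpace (EuclideanSpace ℝ (Fin d)) N] (x : N) :
    FiniteDimensional ℝ (TangentSpace (𝓡 d) x) :=
  inferInstanceAs (FiniteDimensional ℝ (EuclideanSpace ℝ (Fin d)))

theorem finrank_tangentSpace {d : ℕ} {N : Type*} [TopologicalSpace N]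
    [ChartedSpace (EuclideanSpace ℝ (Fin d)) N] (x : N) :
    finrank ℝ (TangentSpace (𝓡 d) x) = d :=
  finrank_euclideanSpace_fin (𝕜 := ℝ) (n := d)

namespace System

variable (S : System m n M F)

/-- The tangent map `T_y κ`. -/
def tκ (y : F) : TangentSpace (𝓡 (m + n)) y →ₗ[ℝ] TangentSpace (𝓡 m) (S.κ y) :=
  (mfderiv (𝓡 (m + n)) (𝓡 m) S.κ y).toLinearMap

/-- The vertical subspace `V_y(κ)`. -/
abbrev vert (y : F) : Submodule ℝ (TangentSpace (𝓡 (m + n)) y) := LinearMap.ker (S.tκ y)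

/-- `i(Z₁) i(Z₂) i(Z₃) Ω = 0` for all vertical `Z₁, Z₂, Z₃`: the form `Ω` vanishes as soon as
three of its arguments are vertical. -/
def VanishesOnThreeVertical : Prop :=
  ∀ (y : F) (v : Fin (m + 1) → TangentSpace (𝓡 (m + n)) y) (a b c : Fin (m + 1)),
    a ≠ b → b ≠ c → a ≠ c → v a ∈ S.vert y → v b ∈ S.vert y → v c ∈ S.vert y → S.Ω y v = 0

variable [IsManifold (𝓡 m) ∞ M] [IsManifold (𝓡 (m + n)) ∞ F] (nab : Connection (m := m) (n := n) S.κ)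

/-- The connection at the point `y`, as a section of `T_y κ`. -/
def sectionAt (y : F) : LinSection (S.tκ y) where
  lift := (nab.lift y).toLinearMap
  comp_lift := nab.comp_lift y

/-- The horizontal subspace `H_y(∇)`. -/
abbrev hor (y : F) : Submodule ℝ (TangentSpace (𝓡 (m + n)) y) := (S.sectionAt nab y).hor

/-- The horizontal lift `(T_y κ |_{H_y(∇)})⁻¹ : T_{κ(y)} M → H_y(∇)`. -/
def horLift (y : F) : TangentSpace (𝓡 m) (S.κ y) →ₗ[ℝ] S.hor nab y :=
  (S.sectionAt nab y).horLift

/-- The volume element `η(κ(y))` on `T_{κ(y)} M`. -/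
def ηAt (y : F) : TangentSpace (𝓡 m) (S.κ y) [⋀^Fin m]→ₗ[ℝ] ℝ :=
  (S.η (S.κ y)).toAlternatingMap

/-- The alternating form `Ω(y)` on `T_y F`. -/
def ΩAt (y : F) : TangentSpace (𝓡 (m + n)) y [⋀^Fin (m + 1)]→ₗ[ℝ] ℝ :=
  (S.Ω y).toAlternatingMap

/-- The `m`-vector `Y(y)`, the horizontal lift of the `m`-vector dual to `η`. -/
def mVector (y : F) : ⋀[ℝ]^m (TangentSpace (𝓡 (m + n)) y) :=
  (S.sectionAt nab y).mVector (finrank_tangentSpace (S.κ y)) (S.ηAt y)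

/-- The linear form `γ(y) = i(Y(y))Ω(y)` on `T_y F`. -/
def gamma (y : F) : Dual ℝ (TangentSpace (𝓡 (m + n)) y) :=
  contract (S.ΩAt y) (S.mVector nab y)

section Submanifold

variable {k : ℕ} {C : Type*} [TopologicalSpace C] [ChartedSpace (EuclideanSpace ℝ (Fin k)) C]
  (j : C → F) (y : C)

/-- The inclusion `T_y C → T_{j(y)} F` of tangent spaces. -/
def tIncl : TangentSpace (𝓡 k) y →ₗ[ℝ] TangentSpace (𝓡 (m + n)) (j y) :=
  (mfderiv (𝓡 k) (𝓡 (m + n)) j y).toLinearMap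

/-- The horizontal part `h^H : T_{κ(y)} M → H_y(∇)` of `h : T_{κ(y)} M → T_y C`. -/
def partH (h : TangentSpace (𝓡 m) (S.κ (j y)) →ₗ[ℝ] TangentSpace (𝓡 k) y) :
    TangentSpace (𝓡 m) (S.κ (j y)) →ₗ[ℝ] S.hor nab (j y) :=
  (S.sectionAt nab (j y)).partH (tIncl j y) h

/-- The endomorphism `h^V ∘ T_y κ` of `T_y F`, for `h : T_{κ(y)} M → T_y C`. -/
def tildeV (h : TangentSpace (𝓡 m) (S.κ (j y)) →ₗ[ℝ] TangentSpace (𝓡 k) y) :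
    TangentSpace (𝓡 (m + n)) (j y) →ₗ[ℝ] TangentSpace (𝓡 (m + n)) (j y) :=
  (S.sectionAt nab (j y)).tildeV (tIncl j y) h

/-- The orthogonal complement of `T_y C` with respect to `Ω` and the connection, a subspace
of `(T_{κ(y)} M ⊗ V_y(κ)⁰) × V_y(κ)`. -/
def orthogonal : Submodule ℝ ((TangentSpace (𝓡 m) (S.κ (j y)) ⊗[ℝ]
    (S.vert (j y)).dualAnnihilator) × S.vert (j y)) :=
  (S.sectionAt nab (j y)).orthogonal (finrank_tangentSpace (S.κ (j y))) (S.ηAt (j y))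
    (S.ΩAt (j y)) (tIncl (k := k) j y)

/-- The field equations at `y ∈ C` for `h : T_{κ(y)} M → T_y C`: `h` is `κ`-transverse, and
`Ω(h(X₁), …, h(Xₘ), Y) = 0` for all `X₁, …, Xₘ ∈ T_{κ(y)} M` and `Y ∈ T_y F`. -/
def SolvesFieldEquations
    (h : TangentSpace (𝓡 m) (S.κ (j y)) →ₗ[ℝ] TangentSpace (𝓡 k) y) : Prop :=
  (∀ X, S.tκ (j y) (tIncl j y (h X)) = X) ∧
  ∀ (X : Fin m → TangentSpace (𝓡 m) (S.κ (j y))) (Y : TangentSpace (𝓡 (m + n)) (j y)),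
    S.Ω (j y) (Fin.snoc (fun i => tIncl j y (h (X i))) Y) = 0

/-- The equations for the horizontal and vertical parts of `h : T_{κ(y)} M → T_y C`:
`h^H` is the horizontal lift, and `i(i((h^V ∘ T_y κ)ᵗ)Y)Ω = -γ` on `V_y(κ)`. -/
def SolvesSplitEquations
    (h : TangentSpace (𝓡 m) (S.κ (j y)) →ₗ[ℝ] TangentSpace (𝓡 k) y) : Prop :=
  S.partH nab j y h = S.horLift nab (j y) ∧
  (contract (S.ΩAt (j y)) (deriv (S.tildeV nab j y h) (S.mVector nab (j y)))).domRestrict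
      (S.vert (j y)) =
    -(S.gamma nab (j y)).domRestrict (S.vert (j y))

end Submanifold

end System

end Geometry

end PreMultisymplectic

end

/-!
A transverse `h : E → C` followed by the inclusion `ι : C → W` is itself a linear section of
`σ : W → E`, so it has its own form `γ^h`, and the field equations for `h` say exactly that
`γ^h = 0`, because the decomposable `m`-vectors of `E` are multiples of the one dual to `η`. On the
image of `h` the form `γ^h` vanishes automatically, since an `(m + 1)`-form on the `m`-dimensional
space `E` is zero; hence only the restriction of `γ^h` to the vertical subspace `V` matters. There,
`Ω` killing triples of vertical vectors makes the expansion of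
`Ω (∇X₁ + h^V X₁, …, ∇Xₘ + h^V Xₘ, Y)` stop at first order:
`γ^h = γ^∇ + i(i((h^V ∘ σ)ᵗ)Y)Ω` on `V`. So the field equations and the split equations have the
same solutions. The split equations ask for `(horLift, -γ^∇|_V)` to lie in the range of `♭`, and a
finite-dimensional subspace is the annihilator of its annihilator under a separating pairing.
-/

namespace PreMultisymplectic

theorem mem_iff_forall_mem_dualAnnihilator_comap {K P Q : Type*} [Field K] [AddCommGroup P]
    [Module K P] [AddCommGroup Q] [Module K Q] {B : P →ₗ[K] Q →ₗ[K] K} (hB : B.SeparatingRight)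
    (R : Submodule K Q) [FiniteDimensional K R] (q : Q) :
    q ∈ R ↔ ∀ p ∈ R.dualAnnihilator.comap B, B p q = 0 := by
  have flip_injective : Function.Injective B.flip :=
    LinearMap.ker_eq_bot.1 (LinearMap.separatingRight_iff_flip_ker_eq_bot.1 hB)
  refine ⟨fun hq p hp => (Submodule.mem_dualAnnihilator _).1 hp q hq, fun hq => ?_⟩
  have flip_mem : B.flip q ∈ R.map B.flip := by
    rw [← Subspace.dualCoannihilator_dualAnnihilator_eq (W := R.map B.flip),
      Submodule.mem_dualAnnihilator]
    refine fun p hp => hq p ((Submodule.mem_dualAnnihilator _).2 fun r hr => ?_)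
    exact (Submodule.mem_dualCoannihilator _).1 hp _ (Submodule.mem_map_of_mem hr)
  obtain ⟨r, hr, hrq⟩ := flip_mem
  exact flip_injective hrq ▸ hr

section AlternatingMap

variable {R W N : Type*} [CommRing R] [AddCommGroup W] [Module R W] [AddCommGroup N] [Module R N]

/-- The alternating map `Ω` vanishes as soon as three of its arguments lie in `V`, the pointwise
form of `System.VanishesOnThreeVertical`. -/
def VanishesOnTriples {κ : Type*} (Ω : W [⋀^κ]→ₗ[R] N) (V : Submodule R W) : Prop :=
  ∀ (v : κ → W) (a b c : κ), a ≠ b → b ≠ c → a ≠ c → v a ∈ V → v b ∈ V → v c ∈ V → Ω v = 0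

theorem VanishesOnTriples.apply_snoc_add {m : ℕ} {Ω : W [⋀^Fin (m + 1)]→ₗ[R] N}
    {V : Submodule R W} (hΩ : VanishesOnTriples Ω V) (v : Fin m → W) {u : Fin m → W}
    (hu : ∀ i, u i ∈ V) {Y : W} (hY : Y ∈ V) :
    Ω (Fin.snoc (v + u) Y) =
      Ω (Fin.snoc v Y) + ∑ i, Ω (Fin.snoc (Function.update v i (u i)) Y) := by
  let f : MultilinearMap R (fun _ : Fin m => W) N :=
    (LinearMap.applyₗ Y).compMultilinearMap Ω.toMultilinearMap.curryRight
  have second_order : ∀ t : Finset (Fin m), 2 ≤ t.card → f (t.piecewise u v) = 0 := by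
    intro t ht
    obtain ⟨a, ha, b, hb, hab⟩ := Finset.one_lt_card.1 ht
    exact hΩ _ a.castSucc b.castSucc (Fin.last m) (by simpa using hab) (Fin.castSucc_lt_last b).ne
      (Fin.castSucc_lt_last a).ne (by simpa [ha] using hu a) (by simpa [hb] using hu b)
      (by simpa using hY)
  calc f (v + u) = f v + f.linearDeriv v u +
        ∑ t : Finset (Fin m) with 2 ≤ t.card, f (t.piecewise u v) :=
        f.map_add_eq_map_add_linearDeriv_add v u
    _ = f v + ∑ i, f (Function.update v i (u i)) := by
        rw [Finset.sum_eq_zero fun t ht => second_order t (Finset.mem_filter.1 ht).2, add_zero,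
          MultilinearMap.linearDeriv_apply]

end AlternatingMap

theorem alternatingMap_eq_zero_of_finrank_lt_card {K E N κ : Type*} [Field K] [AddCommGroup E]
    [Module K E] [FiniteDimensional K E] [AddCommGroup N] [Module K N] [Fintype κ]
    (α : E [⋀^κ]→ₗ[K] N) (h : finrank K E < Fintype.card κ) : α = 0 :=
  AlternatingMap.ext fun v =>
    α.map_linearDependent v fun hv => hv.fintype_card_le_finrank.not_gt h

section MultiVectors

variable {W E : Type*} [AddCommGroup W] [Module ℝ W] [AddCommGroup E] [Module ℝ E] {m : ℕ}

theorem contract_map_comp (Ω : W [⋀^Fin (m + 1)]→ₗ[ℝ] ℝ) (g : E →ₗ[ℝ] W) (Z : ⋀[ℝ]^m E) :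
    contract Ω (exteriorPower.map m g Z) ∘ₗ g = contract (Ω.compLinearMap g) Z := by
  suffices LinearMap.lcomp ℝ ℝ g ∘ₗ contract Ω ∘ₗ exteriorPower.map m g =
      contract (Ω.compLinearMap g) from LinearMap.congr_fun this Z
  refine exteriorPower.linearMap_ext (AlternatingMap.ext fun X => LinearMap.ext fun e => ?_)
  simpa [contract_ιMulti, Function.comp_def] using congrArg Ω (Fin.comp_snoc g X e).symm

theorem contract_map_id_add {Ω : W [⋀^Fin (m + 1)]→ₗ[ℝ] ℝ} {V : Submodule ℝ W}
    (hΩ : VanishesOnTriples Ω V) {A : W →ₗ[ℝ] W} (hA : ∀ w, A w ∈ V) (Z : ⋀[ℝ]^m W) {Y : W}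
    (hY : Y ∈ V) :
    contract Ω (exteriorPower.map m (LinearMap.id + A) Z) Y =
      contract Ω Z Y + contract Ω (deriv A Z) Y := by
  suffices (contract Ω).flip Y ∘ₗ exteriorPower.map m (LinearMap.id + A) =
      (contract Ω).flip Y ∘ₗ (LinearMap.id + deriv A) by
    simpa using LinearMap.congr_fun this Z
  refine exteriorPower.linearMap_ext (AlternatingMap.ext fun v => ?_)
  have map_id_add : ⇑(LinearMap.id + A : W →ₗ[ℝ] W) ∘ v = v + fun i => A (v i) := rfl
  simpa [contract_ιMulti, deriv_ιMulti, map_id_add] using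
    hΩ.apply_snoc_add v (u := fun i => A (v i)) (fun i => hA (v i)) hY

theorem eq_evalMV_smul_unitMV [FiniteDimensional ℝ E] (hE : finrank ℝ E = m)
    {η : E [⋀^Fin m]→ₗ[ℝ] ℝ} (hη : η ≠ 0) (Z : ⋀[ℝ]^m E) :
    Z = evalMV η Z • unitMV hE η := by
  have eval_shift : evalMV η (Z - (evalMV η Z - 1) • unitMV hE η) = 1 := by
    simp [evalMV_unitMV hE hη]
  have shift_eq := unitMV_unique hE hη _ eval_shift
  calc Z = unitMV hE η + (evalMV η Z - 1) • unitMV hE η := sub_eq_iff_eq_add.1 shift_eq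
    _ = evalMV η Z • unitMV hE η := by module

/-- The field equations `Ω(g(X₁), …, g(Xₘ), Y) = 0` for a linear map `g : E → W` that is
transverse to the fibres of `σ`; in the geometric setting `g = ι ∘ h` with `ι : T_y C → T_y F`. -/
def SolvesFieldEquations (σ : W →ₗ[ℝ] E) (Ω : W [⋀^Fin (m + 1)]→ₗ[ℝ] ℝ) (g : E →ₗ[ℝ] W) : Prop :=
  (∀ e, σ (g e) = e) ∧ ∀ (X : Fin m → E) (Y : W), Ω (Fin.snoc (fun i => g (X i)) Y) = 0

end MultiVectors

namespace LinSection

variable {W E C : Type*} [AddCommGroup W] [Module ℝ W] [AddCommGroup E] [Module ℝ E]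
  [AddCommGroup C] [Module ℝ C] {σ : W →ₗ[ℝ] E} (s : LinSection σ)

theorem partH_eq_horLift_iff (ι : C →ₗ[ℝ] W) (h : E →ₗ[ℝ] C) :
    s.partH ι h = s.horLift ↔ ∀ e, σ (ι (h e)) = e := by
  rw [LinearMap.ext_iff]
  exact forall_congr' fun _ => s.horEquiv.symm.injective.eq_iff

theorem id_add_tildeV_comp_lift {ι : C →ₗ[ℝ] W} {h : E →ₗ[ℝ] C} (hσ : ∀ e, σ (ι (h e)) = e) :
    (LinearMap.id + s.tildeV ι h) ∘ₗ s.lift = ι ∘ₗ h := by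
  ext e
  simp [tildeV_apply, projV, s.comp_lift, hσ]

theorem pairing_separatingRight : s.pairing.SeparatingRight := by
  rintro ⟨g, ξ⟩ hq
  have hξ : ξ = 0 := by
    ext Z
    simpa [pairing_apply] using hq (0, Z)
  have hg : g = 0 := by
    refine LinearMap.ext fun e => s.horEquiv.map_eq_zero_iff.1 ?_
    refine (forall_dual_apply_eq_zero_iff ℝ _).1 fun φ => ?_
    have hφ : φ ∘ₗ σ ∈ (LinearMap.ker σ).dualAnnihilator :=
      (Submodule.mem_dualAnnihilator _).2 fun w hw => by simp [LinearMap.mem_ker.1 hw]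
    change φ (σ (g e)) = 0
    simpa [pairing_apply, pairH_tmul] using hq (e ⊗ₜ ⟨φ ∘ₗ σ, hφ⟩, 0)
  rw [hg, hξ, Prod.mk_zero_zero]

variable [FiniteDimensional ℝ E] {m : ℕ} (hE : finrank ℝ E = m) (η : E [⋀^Fin m]→ₗ[ℝ] ℝ)
  (Ω : W [⋀^Fin (m + 1)]→ₗ[ℝ] ℝ)

theorem gamma_lift (e : E) : s.gamma hE η Ω (s.lift e) = 0 := by
  have pullback_eq_zero : Ω.compLinearMap s.lift = 0 :=
    alternatingMap_eq_zero_of_finrank_lt_card _ (by simp [hE])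
  have h := LinearMap.congr_fun (contract_map_comp Ω s.lift (unitMV hE η)) e
  rw [pullback_eq_zero] at h
  exact h.trans (by simp [contract])

theorem gamma_eq_zero_iff_domRestrict :
    s.gamma hE η Ω = 0 ↔ (s.gamma hE η Ω).domRestrict (LinearMap.ker σ) = 0 := by
  refine ⟨fun h => by rw [h]; rfl, fun h => LinearMap.ext fun w => ?_⟩
  have horizontal : s.gamma hE η Ω (s.projH w) = 0 := s.gamma_lift hE η Ω (σ w)
  have vertical : s.gamma hE η Ω (s.projV w) = 0 := LinearMap.congr_fun h (s.projV w)
  rw [← s.projH_add_projV w, map_add, horizontal, vertical, add_zero, LinearMap.zero_apply]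

theorem solvesFieldEquations_lift_iff {η : E [⋀^Fin m]→ₗ[ℝ] ℝ} (hη : η ≠ 0) :
    SolvesFieldEquations σ Ω s.lift ↔ s.gamma hE η Ω = 0 := by
  have contract_decomposable (X : Fin m → E) (Y : W) :
      contract Ω (exteriorPower.map m s.lift (exteriorPower.ιMulti ℝ m X)) Y =
        Ω (Fin.snoc (fun i => s.lift (X i)) Y) := by
    rw [exteriorPower.map_apply_ιMulti, contract_ιMulti]
    rfl
  constructor
  · rintro ⟨-, hfield⟩
    have contract_eq_zero : contract Ω ∘ₗ exteriorPower.map m s.lift = 0 :=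
      exteriorPower.linearMap_ext <| AlternatingMap.ext fun X => LinearMap.ext fun Y =>
        (contract_decomposable X Y).trans (hfield X Y)
    exact LinearMap.congr_fun contract_eq_zero (unitMV hE η)
  · refine fun hγ => ⟨s.comp_lift, fun X Y => ?_⟩
    rw [gamma, mVector] at hγ
    rw [← contract_decomposable, eq_evalMV_smul_unitMV hE hη (exteriorPower.ιMulti ℝ m X),
      map_smul, map_smul, hγ, smul_zero, LinearMap.zero_apply]

/-- The equations for the horizontal and vertical parts of `h : E → C`, where `ι : C → W` is the
inclusion; `System.SolvesSplitEquations` is the case of tangent spaces. -/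
def SolvesSplitEquations (ι : C →ₗ[ℝ] W) (h : E →ₗ[ℝ] C) : Prop :=
  s.partH ι h = s.horLift ∧
    (contract Ω (deriv (s.tildeV ι h) (s.mVector hE η))).domRestrict (LinearMap.ker σ) =
      -(s.gamma hE η Ω).domRestrict (LinearMap.ker σ)

theorem solvesSplitEquations_iff_flat_eq (ι : C →ₗ[ℝ] W) (h : E →ₗ[ℝ] C) :
    s.SolvesSplitEquations hE η Ω ι h ↔
      s.flat hE η Ω ι h = (s.horLift, -(s.gamma hE η Ω).domRestrict (LinearMap.ker σ)) := by
  rw [Prod.ext_iff]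
  rfl

theorem exists_solvesSplitEquations_iff [FiniteDimensional ℝ C] (ι : C →ₗ[ℝ] W) :
    (∃ h : E →ₗ[ℝ] C, s.SolvesSplitEquations hE η Ω ι h) ↔
      ∀ p ∈ s.orthogonal hE η Ω ι, s.pairH p.1 s.horLift - s.gamma hE η Ω p.2 = 0 := by
  simp only [solvesSplitEquations_iff_flat_eq, ← LinearMap.mem_range]
  rw [mem_iff_forall_mem_dualAnnihilator_comap s.pairing_separatingRight]
  simp only [pairing_apply, LinearMap.neg_apply, LinearMap.domRestrict_apply, ← sub_eq_add_neg]
  rfl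

variable {Ω}

theorem gamma_apply_of_mem_ker (hΩ : VanishesOnTriples Ω (LinearMap.ker σ)) {ι : C →ₗ[ℝ] W}
    {h : E →ₗ[ℝ] C} (hσ : ∀ e, σ (ι (h e)) = e) {Y : W} (hY : Y ∈ LinearMap.ker σ) :
    gamma ⟨ι ∘ₗ h, hσ⟩ hE η Ω Y =
      s.gamma hE η Ω Y + contract Ω (deriv (s.tildeV ι h) (s.mVector hE η)) Y := by
  have mVector_eq : mVector ⟨ι ∘ₗ h, hσ⟩ hE η =
      exteriorPower.map m (LinearMap.id + s.tildeV ι h) (s.mVector hE η) := by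
    rw [mVector, mVector, ← LinearMap.comp_apply, ← exteriorPower.map_comp,
      s.id_add_tildeV_comp_lift hσ]
  rw [gamma, mVector_eq]
  exact contract_map_id_add hΩ (fun w => Subtype.property _) _ hY

theorem solvesSplitEquations_iff_solvesFieldEquations {η : E [⋀^Fin m]→ₗ[ℝ] ℝ} (hη : η ≠ 0)
    (hΩ : VanishesOnTriples Ω (LinearMap.ker σ)) (ι : C →ₗ[ℝ] W) (h : E →ₗ[ℝ] C) :
    s.SolvesSplitEquations hE η Ω ι h ↔ SolvesFieldEquations σ Ω (ι ∘ₗ h) := by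
  by_cases hσ : ∀ e, σ (ι (h e)) = e
  · let t : LinSection σ := ⟨ι ∘ₗ h, hσ⟩
    calc s.SolvesSplitEquations hE η Ω ι h
        ↔ (t.gamma hE η Ω).domRestrict (LinearMap.ker σ) = 0 := by
          rw [SolvesSplitEquations, and_iff_right ((s.partH_eq_horLift_iff ι h).2 hσ),
            eq_neg_iff_add_eq_zero, LinearMap.ext_iff, LinearMap.ext_iff]
          refine forall_congr' fun Y => ?_
          simp only [LinearMap.add_apply, LinearMap.domRestrict_apply, t,
            s.gamma_apply_of_mem_ker hE η hΩ hσ Y.2, add_comm]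
      _ ↔ t.gamma hE η Ω = 0 := (t.gamma_eq_zero_iff_domRestrict hE η Ω).symm
      _ ↔ SolvesFieldEquations σ Ω (ι ∘ₗ h) := (t.solvesFieldEquations_lift_iff hE Ω hη).symm
  · exact iff_of_false (fun hs => hσ ((s.partH_eq_horLift_iff ι h).1 hs.1)) fun hf => hσ hf.1

end LinSection

end PreMultisymplectic

open PreMultisymplectic in
theorem mainTheorem11_general {W E C : Type*} [AddCommGroup W] [Module ℝ W] [AddCommGroup E]
    [Module ℝ E] [FiniteDimensional ℝ E] [AddCommGroup C] [Module ℝ C] [FiniteDimensional ℝ C]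
    {σ : W →ₗ[ℝ] E} (s : LinSection σ) {m : ℕ} (hE : finrank ℝ E = m)
    {η : E [⋀^Fin m]→ₗ[ℝ] ℝ} (hη : η ≠ 0) {Ω : W [⋀^Fin (m + 1)]→ₗ[ℝ] ℝ}
    (hΩ : VanishesOnTriples Ω (LinearMap.ker σ)) (ι : C →ₗ[ℝ] W) :
    ((∃ h : E →ₗ[ℝ] C, s.SolvesSplitEquations hE η Ω ι h) ↔
      ∀ p ∈ s.orthogonal hE η Ω ι, s.pairH p.1 s.horLift - s.gamma hE η Ω p.2 = 0) ∧
    ((∃ h : E →ₗ[ℝ] C, SolvesFieldEquations σ Ω (ι ∘ₗ h)) ↔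
      ∀ p ∈ s.orthogonal hE η Ω ι, s.pairH p.1 s.horLift - s.gamma hE η Ω p.2 = 0) := by
  have split_iff := s.exists_solvesSplitEquations_iff hE η Ω ι
  have field_iff_split := exists_congr fun h =>
    (s.solvesSplitEquations_iff_solvesFieldEquations hE hη hΩ ι h).symm
  exact ⟨split_iff, field_iff_split.trans split_iff⟩

theorem mainTheorem11 {m n k : ℕ} (hm : 1 < m) {M F C : Type*}
    [TopologicalSpace M] [ChartedSpace (EuclideanSpace ℝ (Fin m)) M] [IsManifold (𝓡 m) ∞ M]
    [TopologicalSpace F] [ChartedSpace (EuclideanSpace ℝ (Fin (m + n))) F]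
    [IsManifold (𝓡 (m + n)) ∞ F]
    [TopologicalSpace C] [ChartedSpace (EuclideanSpace ℝ (Fin k)) C] [IsManifold (𝓡 k) ∞ C]
    (S : PreMultisymplectic.System m n M F) (hΩ : S.VanishesOnThreeVertical)
    (nab : PreMultisymplectic.Connection (m := m) (n := n) S.κ)
    (j : C → F) (hj : Manifold.IsImmersion (𝓡 k) (𝓡 (m + n)) ∞ j)
    (hj_inj : Function.Injective j) (y : C) :
    ((∃ h : TangentSpace (𝓡 m) (S.κ (j y)) →ₗ[ℝ] TangentSpace (𝓡 k) y,
        S.SolvesSplitEquations nab j y h) ↔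
      ∀ p ∈ S.orthogonal (k := k) nab j y,
        (S.sectionAt nab (j y)).pairH p.1 (S.horLift nab (j y)) - S.gamma nab (j y) p.2 = 0) ∧
    ((∃ h : TangentSpace (𝓡 m) (S.κ (j y)) →ₗ[ℝ] TangentSpace (𝓡 k) y,
        S.SolvesFieldEquations j y h) ↔
      ∀ p ∈ S.orthogonal (k := k) nab j y,
        (S.sectionAt nab (j y)).pairH p.1 (S.horLift nab (j y)) - S.gamma nab (j y) p.2 = 0) :=
  mainTheorem11_general (Ω := S.ΩAt (j y)) (S.sectionAt nab (j y))
    (PreMultisymplectic.finrank_tangentSpace _)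
    (fun h => S.η_ne_zero _ (ContinuousAlternatingMap.toAlternatingMap_injective h)) (hΩ (j y))
    (PreMultisymplectic.System.tIncl j y)
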